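/- Let $p$ be an odd prime and let $m = pt$ with $t \ge 1$. A subset $D$ of a finite group $G$ is a $(v,k,\lambda,\mu)$-partial difference set (PDS) if $|G| = v$, $|D| = k$, every nonidentity element of $D$ can be written as $d_1d_2^{-1}$ with $d_1,d_2\in D$ in exactly $\lambda$ ways, and every nonidentity element of $G\setminus D$ can be so written in exactly $\mu$ ways. Then there is a nonabelian group $\mathcal{G}$ of order $p^{3m}$ that contains a PDS with parameters $$v = p^{3m},\qquad k = (p^m-1)\bigl((p-1)(p^m+1)+1\bigr),$$ $$\lambda = p^m-p+(p^{m+1}-p^m+p)(p-2),\qquad \mu = (p^{m+1}-p^m+p)(p-1).$$ More precisely, put $N = \frac{p^m-1}{p-1}$ and let $G$ be the additive group $\mathrm{GF}(p^m)\times \mathrm{GF}(p^{2m})$. The map $\phi(x,y) = (x^{p^{2t}}, y^{p^{2t}})$ is an automorphism of $G$ of order $p$, and there are primitive elements $\omega$ of $\mathrm{GF}(p^m)$ and $\alpha$ of $\mathrm{GF}(p^{2m})$ such that $$D = \bigcup_{i=0}^{N-1} \bigl(\omega^i\langle\omega^N\rangle\bigr)\times\bigl(\alpha^i\langle\alpha^N\rangle\cup\{0\}\bigr)$$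 is a PDS in $G$ with these parameters and $\phi(D) = D$. Moreover there is a nonabelian subgroup $\mathcal{G}$ of order $p^{3m}$ of $G\rtimes\mathrm{Aut}(G)$ (whose elements are the pairs $(g,\psi)$ with $(g,\psi)(h,\chi) = (g+\psi(h),\psi\chi)$) such that $\psi\in\langle\phi\rangle$ for all $(g,\psi)\in\mathcal{G}$, and $\{(g,\psi)\in\mathcal{G} : g\in D\}$ is a PDS in $\mathcal{G}$ with the same parameters. -/

import Mathlib

/-- `D` is a `(v, k, l, u)`-partial difference set in the finite group `G`: `|G| = v`, `|D| = k`,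
every nonidentity element of `D` is a quotient `d₁ * d₂⁻¹` of elements of `D` in exactly `l` ways,
and every nonidentity element outside `D` in exactly `u` ways. -/
def IsPartialDifferenceSet {G : Type*} [Group G] (D : Set G) (v k l u : ℕ) : Prop :=
  Finite G ∧ Nat.card G = v ∧ D.ncard = k ∧
    (∀ g : G, g ≠ 1 → g ∈ D →
      {d : G × G | d.1 ∈ D ∧ d.2 ∈ D ∧ d.1 * d.2⁻¹ = g}.ncard = l) ∧
    (∀ g : G, g ≠ 1 → g ∉ D →
      {d : G × G | d.1 ∈ D ∧ d.2 ∈ D ∧ d.1 * d.2⁻¹ = g}.ncard = u)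

/-- A partial difference set with the odd Denniston parameters attached to `p` and `m`.
For `2 ≤ p` and `1 ≤ m` none of the natural-number subtractions truncates. -/
def IsOddDennistonPDS {G : Type*} [Group G] (D : Set G) (p m : ℕ) : Prop :=
  IsPartialDifferenceSet D
    (p ^ (3 * m))
    ((p ^ m - 1) * ((p - 1) * (p ^ m + 1) + 1))
    (p ^ m - p + (p ^ (m + 1) - p ^ m + p) * (p - 2))
    ((p ^ (m + 1) - p ^ m + p) * (p - 1))

/-- With `N = (p ^ m - 1) / (p - 1)` (an exact division), the subset
`⋃ i < N, (ω ^ i ⟨ω ^ N⟩) × (α ^ i ⟨α ^ N⟩ ∪ {0})` of `F × E`. -/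
def dennistonSet {F E : Type*} [Field F] [Field E] (p m : ℕ) (ω : Fˣ) (α : Eˣ) : Set (F × E) :=
  ⋃ i ∈ Finset.range ((p ^ m - 1) / (p - 1)),
    {x : F | ∃ h ∈ Subgroup.zpowers (ω ^ ((p ^ m - 1) / (p - 1))), x = ((ω ^ i * h : Fˣ) : F)} ×ˢ
    ({y : E | ∃ h ∈ Subgroup.zpowers (α ^ ((p ^ m - 1) / (p - 1))), y = ((α ^ i * h : Eˣ) : E)}
      ∪ {0})

/-- The automorphism `(x, y) ↦ (x ^ (p ^ n), y ^ (p ^ n))` of the additive group `F × E`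
(written multiplicatively), for finite fields `F` and `E` of characteristic `p`. -/
noncomputable def frobeniusPowerAut (F E : Type*) [Field F] [Field E] [Finite F] [Finite E]
    (p n : ℕ) [Fact p.Prime] [CharP F p] [CharP E p] : MulAut (Multiplicative (F × E)) :=
  AddEquiv.toMultiplicative
    (AddEquiv.prodCongr (iterateFrobeniusEquiv F p n).toAddEquiv
      (iterateFrobeniusEquiv E p n).toAddEquiv)

/-- The holomorph `A ⋊ Aut A` of a group `A`: pairs `⟨a, ψ⟩` with
`⟨a, ψ⟩ * ⟨b, χ⟩ = ⟨a * ψ b, ψ * χ⟩`. -/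
abbrev Holomorph (A : Type*) [Group A] : Type _ := A ⋊[MonoidHom.id (MulAut A)] MulAut A

/-! Write `K` for the prime field, `q = |K|`, `Q = |F|`. Taking `ω` to be the norm of `α` turns the
union of products into `normLineSet`: the pairs with `x ≠ 0` and `N y ∈ K x`
(`dennistonSet_map_norm_eq_normLineSet`). This form shows the invariance under Frobenius.

Completing the square in `∑ e(a N y + Tr (b y))` shows that every nontrivial character sum over this
set is `Q - q` or `Q - q - qQ` (`sum_prodTraceChar_normLineSet`). Two values mean one quadratic
equation for all nontrivial characters, and Fourier inversion (`card_filter_sub_eq_of_addChar`)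
turns it into the difference counts `λ` and `μ`.

For the nonabelian group let `(x, y)` act as `φ ^ Tr x`. Since `φ` preserves traces, the graph of
this action is a subgroup of the holomorph. Its quotient counts equal those in `F × E` because `φ`
preserves the set (`ncard_quotients_holomorphGraph`). -/

section DifferenceCounts

/-! ### Fourier inversion and difference counts -/

variable {G ι : Type*} [AddCommGroup G] [Fintype G] [DecidableEq G] [Fintype ι]

/-- A complex function on a finite abelian group is determined by its sums against a family of
characters satisfying the second orthogonality relation. -/
theorem eq_zero_of_sum_mul_addChar_eq_zero {χ : ι → AddChar G ℂ}
    (hχ : ∀ g, ∑ i, χ i g = if g = 0 then (Fintype.card G : ℂ) else 0)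
    {h : G → ℂ} (hh : ∀ i, ∑ g, h g * χ i g = 0) (v : G) : h v = 0 := by
  -- Fourier inversion at `v`: the inner sum is a delta function at `v`.
  have key : ∑ g, h g * ∑ i, χ i (g - v) = 0 := by
    simp_rw [Finset.mul_sum]
    rw [Finset.sum_comm]
    refine Finset.sum_eq_zero fun i _ => ?_
    simp_rw [sub_eq_add_neg, AddChar.map_add_eq_mul, ← mul_assoc]
    rw [← Finset.sum_mul, hh, zero_mul]
  simp_rw [hχ, sub_eq_zero] at key
  simpa using key

/-- Counting differences of a finite set by means of its character sums. -/
theorem card_filter_sub_eq_of_addChar {χ : ι → AddChar G ℂ}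
    (hχ : ∀ g, ∑ i, χ i g = if g = 0 then (Fintype.card G : ℂ) else 0)
    {D : Finset G} {a b c : ℂ}
    (hD : ∀ i, (∑ d ∈ D, χ i d) * ∑ d ∈ D, χ i (-d) =
      a + b * ∑ d ∈ D, χ i d + c * ∑ g, χ i g) (v : G) :
    (((D ×ˢ D).filter fun d => d.1 - d.2 = v).card : ℂ) =
      (if v = 0 then a else 0) + (if v ∈ D then b else 0) + c := by
  -- The transform of the difference count is `χ(D) * χ(-D)`; those of `δ₀`, the indicator of `D`
  -- and the constant `1` are `1`, `χ(D)` and `∑ g, χ g`.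
  refine sub_eq_zero.1 (eq_zero_of_sum_mul_addChar_eq_zero hχ (h := fun v =>
    (((D ×ˢ D).filter fun d => d.1 - d.2 = v).card : ℂ) -
      ((if v = 0 then a else 0) + (if v ∈ D then b else 0) + c)) (fun i => ?_) v)
  have h1 : ∑ g, (((D ×ˢ D).filter fun d => d.1 - d.2 = g).card : ℂ) * χ i g =
      (∑ d ∈ D, χ i d) * ∑ d ∈ D, χ i (-d) := by
    rw [Finset.sum_mul_sum, ← Finset.sum_product',
      ← Finset.sum_fiberwise (D ×ˢ D) (fun d => d.1 - d.2)]
    refine Finset.sum_congr rfl fun g _ => ?_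
    rw [← nsmul_eq_mul, ← Finset.sum_const]
    refine Finset.sum_congr rfl fun d hd => ?_
    rw [← AddChar.map_add_eq_mul, ← sub_eq_add_neg, (Finset.mem_filter.1 hd).2]
  simp only [sub_mul, add_mul, Finset.sum_sub_distrib, Finset.sum_add_distrib, h1, hD, ite_mul,
    zero_mul, Finset.sum_ite_eq', Finset.mem_univ, if_true,
    AddChar.map_zero_eq_one, ← Finset.mul_sum, Finset.sum_ite_mem, Finset.univ_inter]
  ring

end DifferenceCounts

/-! ### Quadratic exponential sums of the norm form -/

section QuadraticExtension

variable {F E : Type*} [Field F] [Field E] [Fintype F] [Fintype E] [Algebra F E]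

theorem pow_card_pow_card_of_finrank_two (h2 : Module.finrank F E = 2) (y : E) :
    (y ^ Fintype.card F) ^ Fintype.card F = y := by
  have h : Fintype.card E = Fintype.card F * Fintype.card F := by
    rw [Module.card_eq_pow_finrank (K := F), h2, pow_two]
  rw [← pow_mul, ← h, FiniteField.pow_card]

theorem algebraMap_norm_of_finrank_two (h2 : Module.finrank F E = 2) (y : E) :
    algebraMap F E (Algebra.norm F y) = y * y ^ Fintype.card F := by
  rw [FiniteField.algebraMap_norm_eq_prod_pow, h2]
  simp [Finset.prod_range_succ]

theorem algebraMap_trace_of_finrank_two (h2 : Module.finrank F E = 2) (y : E) :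
    algebraMap F E (Algebra.trace F E y) = y + y ^ Fintype.card F := by
  rw [FiniteField.algebraMap_trace_eq_sum_pow, h2]
  simp [Finset.sum_range_succ]

theorem norm_add_of_finrank_two (h2 : Module.finrank F E = 2) (y u : E) :
    Algebra.norm F (y + u) =
      Algebra.norm F y + Algebra.trace F E (y * u ^ Fintype.card F) + Algebra.norm F u := by
  apply (algebraMap F E).injective
  have hfrob : (y + u) ^ Fintype.card F = y ^ Fintype.card F + u ^ Fintype.card F := by
    have := map_add (FiniteField.frobeniusAlgHom F E) y u
    simpa [FiniteField.coe_frobeniusAlgHom] using this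
  simp only [map_add, algebraMap_norm_of_finrank_two h2, algebraMap_trace_of_finrank_two h2,
    mul_pow, pow_card_pow_card_of_finrank_two h2, hfrob]
  ring

/-- Surjectivity of the norm makes the sum `S` independent of `a ≠ 0`. Summing over all `a`, where
`a = 0` contributes `Q²` and only `y = 0` has norm zero, gives `Q² + (Q - 1) S = Q`. -/
theorem sum_addChar_mul_norm (h2 : Module.finrank F E = 2) {e : AddChar F ℂ} (he : e.IsPrimitive)
    {a : F} (ha : a ≠ 0) :
    ∑ y : E, e (a * Algebra.norm F y) = -(Fintype.card F : ℂ) := by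
  classical
  set S := ∑ y : E, e (a * Algebra.norm F y) with hS
  have hinv : ∀ b : F, b ≠ 0 → ∑ y : E, e (b * Algebra.norm F y) = S := by
    intro b hb
    obtain ⟨s, hs⟩ := FiniteField.norm_surjective F E (b / a)
    have hs0 : s ≠ 0 := by
      rintro rfl
      rw [Algebra.norm_zero] at hs
      exact div_ne_zero hb ha hs.symm
    rw [hS, ← Equiv.sum_comp (Equiv.mulLeft₀ s hs0) (fun y => e (a * Algebra.norm F y))]
    refine Finset.sum_congr rfl fun y _ => ?_
    change _ = e (a * Algebra.norm F (s * y))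
    rw [map_mul (Algebra.norm F), hs]
    congr 1
    field_simp
  have htot : ∑ b : F, ∑ y : E, e (b * Algebra.norm F y) = (Fintype.card F : ℂ) := by
    rw [Finset.sum_comm]
    have := fun y : E => AddChar.sum_mulShift (Algebra.norm F y) he
    simp [this, Algebra.norm_eq_zero_iff]
  have hcard : (Fintype.card E : ℂ) = (Fintype.card F : ℂ) ^ 2 := by
    rw [Module.card_eq_pow_finrank (K := F), h2]
    push_cast
    rfl
  rw [← Finset.add_sum_erase _ _ (Finset.mem_univ (0 : F)),
    Finset.sum_congr rfl fun b hb => hinv b (Finset.ne_of_mem_erase hb), Finset.sum_const,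
    Finset.card_erase_of_mem (Finset.mem_univ _), Finset.card_univ, nsmul_eq_mul,
    Nat.cast_sub Fintype.card_pos] at htot
  simp only [zero_mul, AddChar.map_zero_eq_one, Finset.sum_const, Finset.card_univ, nsmul_eq_mul,
    mul_one, hcard, Nat.cast_one] at htot
  have hne : (Fintype.card F : ℂ) - 1 ≠ 0 := by
    have : (Fintype.card F : ℂ) ≠ 1 := by exact_mod_cast (Fintype.one_lt_card (α := F)).ne'
    exact sub_ne_zero.2 this
  apply mul_left_cancel₀ hne
  linear_combination htot

/-- Complete the square: with `u` the conjugate of `b / a`, the expansion of `a N(y + u)` has cross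
term `Tr (b y)` and constant term `N b / a`. -/
theorem sum_addChar_mul_norm_add_trace (h2 : Module.finrank F E = 2) {e : AddChar F ℂ}
    (he : e.IsPrimitive) {a : F} (ha : a ≠ 0) (b : E) :
    ∑ y : E, e (a * Algebra.norm F y + Algebra.trace F E (b * y)) =
      -(Fintype.card F : ℂ) * e (-(Algebra.norm F b / a)) := by
  have ha' : algebraMap F E a ≠ 0 := by simpa using ha
  set u : E := (b / algebraMap F E a) ^ Fintype.card F with hu
  have huQ : u ^ Fintype.card F = b / algebraMap F E a := pow_card_pow_card_of_finrank_two h2 _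
  have hNu : a * Algebra.norm F u = Algebra.norm F b / a := by
    have hmul := congrArg (Algebra.norm F) (div_mul_cancel₀ b ha')
    rw [map_mul, Algebra.norm_algebraMap, h2] at hmul
    rw [hu, map_pow, FiniteField.pow_card, ← hmul]
    field_simp
  rw [← sum_addChar_mul_norm h2 he ha,
    ← Equiv.sum_comp (Equiv.addRight u) (fun y => e (a * Algebra.norm F y)), Finset.sum_mul]
  refine Finset.sum_congr rfl fun y _ => ?_
  rw [← AddChar.map_add_eq_mul]
  congr 1
  have htr : a * Algebra.trace F E (y * (b / algebraMap F E a)) = Algebra.trace F E (b * y) := by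
    rw [← smul_eq_mul, ← map_smul, Algebra.smul_def]
    congr 1
    field_simp
  rw [Equiv.coe_addRight, norm_add_of_finrank_two h2, huQ, ← hNu, ← htr]
  ring

end QuadraticExtension

/-! ### The norm-line set and its character sums -/

section NormLineSet

/-- The pairs `(x, y)` in `F × E` with `x ≠ 0` whose norm `N_{E/F} y` is a `K`-multiple of `x`. -/
def normLineSet (K F E : Type*) [Field K] [Field F] [Field E] [Algebra K F] [Algebra F E] :
    Set (F × E) :=
  {g | g.1 ≠ 0 ∧ ∃ c : K, Algebra.norm F g.2 = c • g.1}

variable {K F E : Type*} [Field K] [Field F] [Field E] [Algebra K F] [Algebra F E]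

theorem mem_normLineSet {g : F × E} :
    g ∈ normLineSet K F E ↔ g.1 ≠ 0 ∧ ∃ c : K, Algebra.norm F g.2 = c • g.1 := Iff.rfl

/-- The additive character `(x, y) ↦ e (a x + Tr_{E/F} (b y))` of `F × E`. -/
noncomputable def prodTraceChar (e : AddChar F ℂ) (i : F × E) : AddChar (F × E) ℂ where
  toFun g := e (i.1 * g.1 + Algebra.trace F E (i.2 * g.2))
  map_zero_eq_one' := by simp
  map_add_eq_mul' g h := by
    rw [← AddChar.map_add_eq_mul]
    congr 1
    simp only [Prod.fst_add, Prod.snd_add, mul_add, map_add]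
    ring

theorem prodTraceChar_apply (e : AddChar F ℂ) (i g : F × E) :
    prodTraceChar e i g = e (i.1 * g.1 + Algebra.trace F E (i.2 * g.2)) := rfl

variable [Fintype K] [Fintype F] [Fintype E]

open scoped Classical

/-- If `y ≠ 0` then `N y ≠ 0`, so the admissible `x` are exactly the `c • N y` for distinct `c ∈
K*`; if `y = 0`, every `x ≠ 0` is admissible. -/
theorem sum_normLineSet {M : Type*} [AddCommMonoid M] (f : F × E → M) :
    ∑ g ∈ (normLineSet K F E).toFinset, f g =
      ∑ x ∈ Finset.univ.erase (0 : F), f (x, 0) +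
        ∑ c ∈ Finset.univ.erase (0 : K), ∑ y ∈ Finset.univ.erase (0 : E),
          f (c • Algebra.norm F y, y) := by
  have hN : ∀ y : E, Algebra.norm F y = 0 ↔ y = 0 := fun y => Algebra.norm_eq_zero_iff
  rw [← Finset.sum_filter_add_sum_filter_not _ (fun g : F × E => g.2 = 0)]
  congr 1
  · refine Finset.sum_bij' (fun g _ => g.1) (fun x _ => (x, 0)) ?_ ?_ ?_ ?_ ?_
    · rintro ⟨x, y⟩ hg
      simp only [Finset.mem_filter, Set.mem_toFinset, mem_normLineSet] at hg
      simpa using hg.1.1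
    · intro x hx
      simp only [Finset.mem_filter, Set.mem_toFinset, mem_normLineSet, and_true]
      exact ⟨Finset.ne_of_mem_erase hx, 0, by rw [Algebra.norm_zero, zero_smul]⟩
    · rintro ⟨x, y⟩ hg
      simp only [Finset.mem_filter] at hg
      simp [hg.2]
    · simp
    · rintro ⟨x, y⟩ hg
      simp only [Finset.mem_filter] at hg
      simp [hg.2]
  · rw [← Finset.sum_product']
    symm
    refine Finset.sum_bij (fun d _ => (d.1 • Algebra.norm F d.2, d.2)) ?_ ?_ ?_ ?_
    · rintro ⟨c, y⟩ hd
      simp only [Finset.mem_product, Finset.mem_erase, Finset.mem_univ, and_true] at hd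
      simp only [Finset.mem_filter, Set.mem_toFinset, mem_normLineSet]
      exact ⟨⟨smul_ne_zero hd.1 ((hN y).not.2 hd.2), c⁻¹, (inv_smul_smul₀ hd.1 _).symm⟩, hd.2⟩
    · rintro ⟨c, y⟩ hd ⟨c', y'⟩ hd' h
      simp only [Finset.mem_product, Finset.mem_erase, Finset.mem_univ, and_true] at hd hd'
      obtain ⟨h1, rfl⟩ := Prod.mk.inj h
      exact congrArg (·, y) (smul_left_injective K ((hN y).not.2 hd.2) h1)
    · rintro ⟨x, y⟩ hg
      simp only [Finset.mem_filter, Set.mem_toFinset, mem_normLineSet] at hg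
      obtain ⟨⟨hx, c, hc⟩, hy⟩ := hg
      have hc0 : c ≠ 0 := by
        rintro rfl
        rw [zero_smul] at hc
        exact hy ((hN y).1 hc)
      refine ⟨(c⁻¹, y), ?_, ?_⟩
      · simp [hc0, hy]
      · simp only [hc, inv_smul_smul₀ hc0]
    · intro d hd
      rfl

theorem card_normLineSet (h2 : Module.finrank F E = 2) :
    (normLineSet K F E).toFinset.card =
      (Fintype.card F - 1) * ((Fintype.card K - 1) * (Fintype.card F + 1) + 1) := by
  have hE : Fintype.card E - 1 = (Fintype.card F - 1) * (Fintype.card F + 1) := by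
    rw [Module.card_eq_pow_finrank (K := F), h2, mul_comm, ← Nat.sq_sub_sq, one_pow]
  have h := sum_normLineSet (K := K) (F := F) (E := E) fun _ => 1
  simp only [Finset.sum_const, smul_eq_mul, mul_one, Finset.card_erase_of_mem (Finset.mem_univ _),
    Finset.card_univ, hE] at h
  rw [h]
  ring

theorem isPrimitive_comp_trace {e : AddChar K ℂ} (he : e.IsPrimitive) :
    (e.compAddMonoidHom (Algebra.trace K F).toAddMonoidHom).IsPrimitive := by
  refine AddChar.IsPrimitive.of_ne_one fun h => ?_
  have h1 := he one_ne_zero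
  refine h1 (DFunLike.ext _ _ fun x => ?_)
  obtain ⟨y, rfl⟩ := Algebra.trace_surjective K F x
  simpa using DFunLike.congr_fun h y

theorem sum_prodTraceChar {e : AddChar F ℂ} (he : e.IsPrimitive) (g : F × E) :
    ∑ i, prodTraceChar e i g = if g = 0 then (Fintype.card (F × E) : ℂ) else 0 := by
  obtain ⟨x, y⟩ := g
  have h1 := AddChar.sum_mulShift x he
  have h2 := AddChar.sum_mulShift y (isPrimitive_comp_trace (F := E) he)
  simp only [AddChar.compAddMonoidHom_apply, LinearMap.toAddMonoidHom_coe] at h2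
  simp only [prodTraceChar_apply, Fintype.sum_prod_type, AddChar.map_add_eq_mul, ← Finset.mul_sum,
    h2, ← Finset.sum_mul, h1, Prod.mk_eq_zero, Fintype.card_prod]
  split_ifs <;> simp_all

theorem sum_prodTraceChar_right {e : AddChar F ℂ} (he : e.IsPrimitive) (i : F × E) :
    ∑ g, prodTraceChar e i g = if i = 0 then (Fintype.card (F × E) : ℂ) else 0 := by
  rw [← sum_prodTraceChar he]
  simp only [prodTraceChar_apply, mul_comm]

/-- For `a ≠ 0` the sum over `y` is, up to the missing `y = 0` term, `-Q e(-c⁻¹ Tr (N b / a))`.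
Summing over `c` is then a character sum of `K`, which detects whether that trace vanishes. -/
theorem sum_prodTraceChar_normLineSet (h2 : Module.finrank F E = 2) {e : AddChar K ℂ}
    (he : e.IsPrimitive) {i : F × E} (hi : i ≠ 0) :
    ∑ g ∈ (normLineSet K F E).toFinset,
      prodTraceChar (e.compAddMonoidHom (Algebra.trace K F).toAddMonoidHom) i g =
    (Fintype.card F : ℂ) - Fintype.card K -
      if i.1 ≠ 0 ∧ Algebra.trace K F (Algebra.norm F i.2 / i.1) = 0 then
        (Fintype.card K : ℂ) * Fintype.card F else 0 := by
  obtain ⟨a, b⟩ := i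
  set ε := e.compAddMonoidHom (Algebra.trace K F).toAddMonoidHom with hε
  have hεp : ε.IsPrimitive := isPrimitive_comp_trace he
  have hK : ((Fintype.card K - 1 : ℕ) : ℂ) = Fintype.card K - 1 := by
    rw [Nat.cast_sub Fintype.card_pos, Nat.cast_one]
  rw [sum_normLineSet]
  simp only [prodTraceChar_apply, mul_zero, map_zero, add_zero]
  have hx : ∑ x ∈ Finset.univ.erase (0 : F), ε (a * x) =
      (if a = 0 then (Fintype.card F : ℂ) else 0) - 1 := by
    have h := AddChar.sum_mulShift a hεp
    rw [← Finset.add_sum_erase _ _ (Finset.mem_univ (0 : F)), zero_mul,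
      AddChar.map_zero_eq_one] at h
    simp only [mul_comm a]
    rw [eq_sub_iff_add_eq', h, Nat.cast_ite, Nat.cast_zero]
  rw [hx]
  rcases eq_or_ne a 0 with rfl | ha
  · have hb : b ≠ 0 := fun h => hi (by rw [h, Prod.mk_zero_zero])
    have hy : ∑ y ∈ Finset.univ.erase (0 : E), ε (Algebra.trace F E (b * y)) = -1 := by
      have := AddChar.sum_mulShift b (isPrimitive_comp_trace (F := E) hεp)
      rw [if_neg hb, ← Finset.add_sum_erase _ _ (Finset.mem_univ (0 : E))] at this
      simp only [AddChar.compAddMonoidHom_apply, LinearMap.toAddMonoidHom_coe, zero_mul,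
        AddChar.map_zero_eq_one] at this
      simp only [mul_comm b]
      linear_combination this
    simp only [zero_mul, zero_add, hy, Finset.sum_const, nsmul_eq_mul,
      Finset.card_erase_of_mem (Finset.mem_univ _), Finset.card_univ, hK]
    simp only [ne_eq, not_true_eq_false, false_and, if_false, if_true]
    ring
  · have hy : ∀ c ∈ Finset.univ.erase (0 : K), ∑ y ∈ Finset.univ.erase (0 : E),
        ε (a * c • Algebra.norm F y + Algebra.trace F E (b * y)) =
        -(Fintype.card F : ℂ) * e (c⁻¹ * -Algebra.trace K F (Algebra.norm F b / a)) - 1 := by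
      intro c hc
      have hc0 : c ≠ 0 := Finset.ne_of_mem_erase hc
      have := sum_addChar_mul_norm_add_trace h2 hεp (smul_ne_zero hc0 ha) b
      rw [← Finset.add_sum_erase _ _ (Finset.mem_univ (0 : E))] at this
      have hdiv : -(Algebra.norm F b / c • a) = c⁻¹ • -(Algebra.norm F b / a) := by
        have : algebraMap K F c ≠ 0 := by simpa using hc0
        rw [Algebra.smul_def, Algebra.smul_def, map_inv₀]
        field_simp
      simp only [Algebra.norm_zero, mul_zero, map_zero, add_zero, AddChar.map_zero_eq_one, hdiv,
        smul_mul_assoc] at this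
      rw [hε, AddChar.compAddMonoidHom_apply _ _ (c⁻¹ • _), LinearMap.toAddMonoidHom_coe,
        map_smul, map_neg, smul_eq_mul, ← hε] at this
      simp only [mul_smul_comm]
      linear_combination this
    rw [Finset.sum_congr rfl hy, Finset.sum_sub_distrib, ← Finset.mul_sum]
    have hc : ∑ c ∈ Finset.univ.erase (0 : K),
        e (c⁻¹ * -Algebra.trace K F (Algebra.norm F b / a)) =
        (if Algebra.trace K F (Algebra.norm F b / a) = 0 then (Fintype.card K : ℂ) else 0) - 1 := by
      have h := AddChar.sum_mulShift (-Algebra.trace K F (Algebra.norm F b / a)) he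
      -- Inversion with `0⁻¹ = 0` permutes all of `K`, fixing the excluded point.
      rw [← Equiv.sum_comp (Equiv.inv K), ← Finset.add_sum_erase _ _ (Finset.mem_univ (0 : K))] at h
      simp only [Equiv.inv_apply, inv_zero, zero_mul, AddChar.map_zero_eq_one, neg_eq_zero] at h
      rw [eq_sub_iff_add_eq', h, Nat.cast_ite, Nat.cast_zero]
    rw [hc]
    simp only [Finset.sum_const, nsmul_eq_mul, Finset.card_erase_of_mem (Finset.mem_univ _),
      Finset.card_univ, hK, ha, ne_eq, not_false_eq_true, true_and, if_false]
    split_ifs <;> ring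

theorem card_filter_sub_normLineSet (h2 : Module.finrank F E = 2) (v : F × E) (hv : v ≠ 0) :
    ((((normLineSet K F E).toFinset ×ˢ (normLineSet K F E).toFinset).filter
      fun d => d.1 - d.2 = v).card : ℂ) =
    (if v ∈ normLineSet K F E then
      2 * (Fintype.card F : ℂ) - 2 * Fintype.card K - Fintype.card K * Fintype.card F else 0) +
    (Fintype.card K * Fintype.card F - Fintype.card F + Fintype.card K) * (Fintype.card K - 1) := by
  obtain ⟨e, he⟩ : ∃ e : AddChar K ℂ, e.IsPrimitive := by
    obtain ⟨e, he⟩ := AddChar.exists_apply_ne_zero.2 (one_ne_zero (α := K))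
    exact ⟨e, AddChar.IsPrimitive.of_ne_one fun h => he (by rw [h, AddChar.one_apply])⟩
  set q : ℂ := (Fintype.card K : ℂ) with hq
  set Q : ℂ := (Fintype.card F : ℂ) with hQ
  set ε := e.compAddMonoidHom (Algebra.trace K F).toAddMonoidHom with hε
  have hεp : ε.IsPrimitive := isPrimitive_comp_trace he
  have hk : ((normLineSet K F E).toFinset.card : ℂ) = (Q - 1) * ((q - 1) * (Q + 1) + 1) := by
    rw [card_normLineSet h2]
    push_cast [Nat.cast_sub (Fintype.card_pos (α := F)), Nat.cast_sub (Fintype.card_pos (α := K))]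
    rfl
  have hE : (Fintype.card (F × E) : ℂ) = Q ^ 3 := by
    rw [Fintype.card_prod, Module.card_eq_pow_finrank (K := F) (V := E), h2]
    push_cast
    ring
  -- For the character values `θ₁ = Q - q` and `θ₂ = Q - q - qQ`, `a = -θ₁θ₂` and `b = θ₁ + θ₂`; the
  -- trivial character then forces `c = μ`, from `k² = a + b k + c Q³`.
  rw [card_filter_sub_eq_of_addChar (sum_prodTraceChar hεp) (a := (Q - q) * (q * Q - Q + q))
    (b := 2 * Q - 2 * q - q * Q) (c := (q * Q - Q + q) * (q - 1)) _ v]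
  · simp only [hv, Set.mem_toFinset, if_false, zero_add]
  · intro i
    rcases eq_or_ne i 0 with rfl | hi
    · simp only [prodTraceChar_apply, Prod.fst_zero, Prod.snd_zero, zero_mul, map_zero, add_zero,
        AddChar.map_zero_eq_one, Finset.sum_const, nsmul_eq_mul, mul_one, hk, Finset.card_univ, hE]
      ring
    -- Negating `i` only changes the sign of `N b / a`, so the vanishing of its trace is unaffected.
    · have hneg : ∑ d ∈ (normLineSet K F E).toFinset, prodTraceChar ε i (-d) =
          ∑ d ∈ (normLineSet K F E).toFinset, prodTraceChar ε i d := by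
        have h : ∀ d, prodTraceChar ε i (-d) = prodTraceChar ε (-i) d := fun d => by
          simp [prodTraceChar_apply]
        have hN : Algebra.norm F (-i.2) = Algebra.norm F i.2 := by
          rw [← neg_one_smul F i.2, Algebra.smul_def, map_mul, Algebra.norm_algebraMap, h2]
          simp
        simp only [h]
        rw [sum_prodTraceChar_normLineSet h2 he hi,
          sum_prodTraceChar_normLineSet h2 he (neg_ne_zero.2 hi)]
        simp only [Prod.fst_neg, Prod.snd_neg, hN, div_neg, map_neg, neg_eq_zero, ne_eq]
      rw [hneg, sum_prodTraceChar_right hεp, if_neg hi, sum_prodTraceChar_normLineSet h2 he hi]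
      split_ifs <;> ring

theorem isPartialDifferenceSet_normLineSet (h2 : Module.finrank F E = 2) :
    IsPartialDifferenceSet (Multiplicative.toAdd ⁻¹' normLineSet K F E) (Fintype.card F ^ 3)
      ((Fintype.card F - 1) * ((Fintype.card K - 1) * (Fintype.card F + 1) + 1))
      (Fintype.card F - Fintype.card K +
        (Fintype.card K * Fintype.card F - Fintype.card F + Fintype.card K) *
          (Fintype.card K - 2))
      ((Fintype.card K * Fintype.card F - Fintype.card F + Fintype.card K) *
        (Fintype.card K - 1)) := by
  -- These bounds let the natural subtractions be cast to `ℂ`.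
  have hK2 : 2 ≤ Fintype.card K := Fintype.one_lt_card
  have hKF : Fintype.card K ≤ Fintype.card F :=
    Fintype.card_le_of_injective _ (algebraMap K F).injective
  have hF : Fintype.card F ≤ Fintype.card K * Fintype.card F :=
    Nat.le_mul_of_pos_left _ Fintype.card_pos
  have hcount : ∀ g : Multiplicative (F × E),
      {d : Multiplicative (F × E) × Multiplicative (F × E) |
        d.1 ∈ Multiplicative.toAdd ⁻¹' normLineSet K F E ∧
        d.2 ∈ Multiplicative.toAdd ⁻¹' normLineSet K F E ∧ d.1 * d.2⁻¹ = g}.ncard =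
      (((normLineSet K F E).toFinset ×ˢ (normLineSet K F E).toFinset).filter
        fun d => d.1 - d.2 = g.toAdd).card := by
    intro g
    rw [← Set.ncard_coe_finset]
    congr 1
    ext d
    simp only [Set.mem_ofPred_eq, Finset.coe_filter, Finset.mem_product, Set.mem_toFinset,
      and_assoc]
    rw [← div_eq_mul_inv]
    rfl
  refine ⟨inferInstance, ?_, ?_, fun g hg hgD => ?_, fun g hg hgD => ?_⟩
  · rw [Nat.card_congr Multiplicative.toAdd, Nat.card_prod, Nat.card_eq_fintype_card,
      Nat.card_eq_fintype_card, Module.card_eq_pow_finrank (K := F) (V := E), h2]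
    ring
  · rw [← card_normLineSet h2, ← Set.ncard_coe_finset, Set.coe_toFinset]
    rfl
  · rw [Set.mem_preimage] at hgD
    rw [hcount, ← Nat.cast_inj (R := ℂ), card_filter_sub_normLineSet (K := K) h2 g.toAdd hg, if_pos hgD]
    push_cast [Nat.cast_sub hK2, Nat.cast_sub hKF, Nat.cast_sub hF]
    ring
  · rw [Set.mem_preimage] at hgD
    rw [hcount, ← Nat.cast_inj (R := ℂ), card_filter_sub_normLineSet (K := K) h2 g.toAdd hg, if_neg hgD]
    push_cast [Nat.cast_sub (one_le_two.trans hK2), Nat.cast_sub hF]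
    ring

end NormLineSet

/-! ### Regular subgroups of the holomorph -/

section Holomorph

variable {A : Type*} [Group A]

/-- The graph of a homomorphism `ρ : A → Aut A` with `ρ (ρ a b) = ρ b`, a subgroup of the holomorph
that acts regularly on `A`. -/
def holomorphGraph (ρ : A →* MulAut A) (hρ : ∀ a b, ρ (ρ a b) = ρ b) :
    Subgroup (Holomorph A) where
  carrier := {g | g.right = ρ g.left}
  one_mem' := by simp
  mul_mem' := by
    intro g h hg hh
    simp only [Set.mem_ofPred_eq] at hg hh ⊢
    rw [SemidirectProduct.mul_right, SemidirectProduct.mul_left, MonoidHom.id_apply, map_mul, hg,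
      hρ, hh]
  inv_mem' := by
    intro g hg
    simp only [Set.mem_ofPred_eq] at hg ⊢
    rw [SemidirectProduct.inv_right, SemidirectProduct.inv_left, MonoidHom.id_apply, hg,
      ← map_inv ρ g.left, hρ, map_inv]

variable {ρ : A →* MulAut A} {hρ : ∀ a b, ρ (ρ a b) = ρ b}

theorem mem_holomorphGraph {g : Holomorph A} : g ∈ holomorphGraph ρ hρ ↔ g.right = ρ g.left :=
  Iff.rfl

/-- Elements of the graph correspond to their first components. -/
def holomorphGraphEquiv (ρ : A →* MulAut A) (hρ : ∀ a b, ρ (ρ a b) = ρ b) :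
    holomorphGraph ρ hρ ≃ A where
  toFun g := g.1.left
  invFun a := ⟨⟨a, ρ a⟩, rfl⟩
  left_inv g := Subtype.ext (SemidirectProduct.ext rfl g.2.symm)
  right_inv _ := rfl

theorem holomorphGraphEquiv_apply (g : holomorphGraph ρ hρ) :
    holomorphGraphEquiv ρ hρ g = g.1.left := rfl

theorem holomorphGraphEquiv_mul (g h : holomorphGraph ρ hρ) :
    holomorphGraphEquiv ρ hρ (g * h) =
      holomorphGraphEquiv ρ hρ g * ρ (holomorphGraphEquiv ρ hρ g) (holomorphGraphEquiv ρ hρ h) := by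
  have := g.2
  rw [mem_holomorphGraph] at this
  simp only [holomorphGraphEquiv_apply, Subgroup.coe_mul, SemidirectProduct.mul_left,
    MonoidHom.id_apply, this]

/-- In the graph, `d₁ = g d₂` reads `a₁ = g · ρ(g)(a₂)` on first components. Replacing `a₂` by
`ρ(g)(a₂)` is a bijection preserving `D`. -/
theorem ncard_quotients_holomorphGraph {D : Set A} (hD : ∀ a b, ρ a b ∈ D ↔ b ∈ D)
    (g : holomorphGraph ρ hρ) :
    {d : holomorphGraph ρ hρ × holomorphGraph ρ hρ |
      d.1.1.left ∈ D ∧ d.2.1.left ∈ D ∧ d.1 * d.2⁻¹ = g}.ncard =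
    {d : A × A | d.1 ∈ D ∧ d.2 ∈ D ∧ d.1 * d.2⁻¹ = g.1.left}.ncard := by
  set ε := holomorphGraphEquiv ρ hρ
  have key : ∀ d₁ d₂ : holomorphGraph ρ hρ,
      d₁ * d₂⁻¹ = g ↔ ε d₁ * (ρ (ε g) (ε d₂))⁻¹ = ε g := fun d₁ d₂ => by
    rw [mul_inv_eq_iff_eq_mul, mul_inv_eq_iff_eq_mul, ← holomorphGraphEquiv_mul,
      (holomorphGraphEquiv ρ hρ).apply_eq_iff_eq]
  let Φ : holomorphGraph ρ hρ × holomorphGraph ρ hρ ≃ A × A :=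
    Equiv.prodCongr ε (ε.trans (ρ (ε g)).toEquiv)
  rw [← Set.ncard_image_of_injective _ Φ.injective, Equiv.image_eq_preimage_symm]
  congr 1
  ext ⟨a, b⟩
  obtain ⟨⟨d₁, d₂⟩, hd⟩ := Φ.surjective (a, b)
  rw [Set.mem_preimage, ← hd, Equiv.symm_apply_apply]
  change ε d₁ ∈ D ∧ ε d₂ ∈ D ∧ d₁ * d₂⁻¹ = g ↔
    ε d₁ ∈ D ∧ ρ (ε g) (ε d₂) ∈ D ∧ ε d₁ * (ρ (ε g) (ε d₂))⁻¹ = ε g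
  rw [hD, key]

/-- A partial difference set invariant under the image of `ρ` lifts to the graph of `ρ`. -/
theorem IsPartialDifferenceSet.holomorphGraph {D : Set A} {v k l u : ℕ}
    (h : IsPartialDifferenceSet D v k l u) (hD : ∀ a b, ρ a b ∈ D ↔ b ∈ D) :
    IsPartialDifferenceSet {g : holomorphGraph ρ hρ | g.1.left ∈ D} v k l u := by
  obtain ⟨hfin, hv, hk, hl, hu⟩ := h
  have hone : ∀ g : _root_.holomorphGraph ρ hρ, g ≠ 1 → g.1.left ≠ 1 := fun g hg h1 => hg <|
    (holomorphGraphEquiv ρ hρ).injective h1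
  refine ⟨Finite.of_equiv _ (holomorphGraphEquiv ρ hρ).symm, ?_, ?_, fun g hg hgD => ?_,
    fun g hg hgD => ?_⟩
  · rw [Nat.card_congr (holomorphGraphEquiv ρ hρ), hv]
  · rw [← hk, ← Set.ncard_image_of_injective _ (holomorphGraphEquiv ρ hρ).symm.injective,
      Equiv.image_symm_eq_preimage]
    rfl
  · exact (ncard_quotients_holomorphGraph hD g).trans (hl _ (hone g hg) hgD)
  · exact (ncard_quotients_holomorphGraph hD g).trans (hu _ (hone g hg) hgD)

end Holomorph

/-! ### Cyclotomic description of the norm-line set -/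

section DennistonSet

variable {p m : ℕ} [Fact p.Prime] {F E : Type*} [Field F] [Field E] [Finite F] [Finite E]
  [Algebra (ZMod p) F] [Algebra F E]

theorem orderOf_of_zpowers_eq_top {K : Type*} [Field K] [Finite K] {ω : Kˣ}
    (hω : Subgroup.zpowers ω = ⊤) : orderOf ω = Nat.card K - 1 := by
  rw [← Nat.card_zpowers, hω, Subgroup.card_top, Nat.card_units]

theorem zpow_mem_zpowers_pow_iff {G : Type*} [Group G] {g : G} {n : ℕ} (hn : n ∣ orderOf g)
    (j : ℤ) : g ^ j ∈ Subgroup.zpowers (g ^ n) ↔ (n : ℤ) ∣ j := by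
  constructor
  · rintro ⟨k, hk⟩
    have hk' : g ^ ((n : ℤ) * k) = g ^ j := by
      rw [zpow_mul, zpow_natCast]
      exact hk
    have h := (Int.natCast_dvd_natCast.2 hn).trans (orderOf_dvd_sub_iff_zpow_eq_zpow.2 hk')
    exact (dvd_sub_right (dvd_mul_right _ _)).1 h
  · rintro ⟨k, rfl⟩
    exact ⟨k, by simp only [zpow_mul, zpow_natCast]⟩

/-- The subgroup `⟨ω ^ N⟩` of the multiplicative group is that of the prime field. -/
theorem mem_zpowers_pow_iff_exists_algebraMap [CharP F p] (hF : Nat.card F = p ^ m) {ω : Fˣ}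
    (hω : Subgroup.zpowers ω = ⊤) (h : Fˣ) :
    h ∈ Subgroup.zpowers (ω ^ ((p ^ m - 1) / (p - 1))) ↔
      ∃ c : ZMod p, (h : F) = algebraMap (ZMod p) F c := by
  have hp := (Fact.out : p.Prime)
  have hp1 : 0 < p - 1 := Nat.sub_pos_of_lt hp.one_lt
  have hN : (p ^ m - 1) / (p - 1) * (p - 1) = p ^ m - 1 :=
    Nat.div_mul_cancel (Nat.sub_one_dvd_pow_sub_one p m)
  have hord : orderOf ω = p ^ m - 1 := by rw [orderOf_of_zpowers_eq_top hω, hF]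
  -- Both sides of the claim are equivalent to `h ^ (p - 1) = 1`.
  have hpow : h ∈ Subgroup.zpowers (ω ^ ((p ^ m - 1) / (p - 1))) ↔ h ^ (p - 1) = 1 := by
    obtain ⟨j, rfl⟩ : h ∈ Subgroup.zpowers ω := hω ▸ Subgroup.mem_top h
    simp only
    rw [zpow_mem_zpowers_pow_iff (n := (p ^ m - 1) / (p - 1)) (by rw [hord]; exact Dvd.intro _ hN), ← zpow_natCast, ← zpow_mul,
      ← orderOf_dvd_iff_zpow_eq_one, hord]
    nth_rewrite 2 [← hN]
    rw [Nat.cast_mul, mul_dvd_mul_iff_right (by exact_mod_cast hp1.ne')]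
  rw [hpow]
  constructor
  · intro h1
    have h2 : (h : F) ^ p = h := by
      rw [← Nat.sub_add_cancel hp.one_le, pow_succ, ← Units.val_pow_eq_pow_val, h1, Units.val_one,
        one_mul]
    obtain ⟨n, hn⟩ := (mem_bot_iff_intCast p F).1
      ((Subfield.mem_bot_iff_pow_eq_self F p).2 h2)
    exact ⟨n, by rw [map_intCast, hn]⟩
  · rintro ⟨c, hc⟩
    have hc0 : c ≠ 0 := by
      rintro rfl
      exact h.ne_zero (by rw [hc, map_zero])
    ext
    rw [Units.val_pow_eq_pow_val, hc, ← map_pow, ZMod.pow_card_sub_one_eq_one hc0, map_one,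
      Units.val_one]

theorem zpowers_map_norm_eq_top {F E : Type*} [Field F] [Field E] [Finite E] [Algebra F E] {α : Eˣ} (hα : Subgroup.zpowers α = ⊤) :
    Subgroup.zpowers (Units.map (Algebra.norm F) α) = ⊤ := by
  rw [← MonoidHom.map_zpowers, hα]
  exact Subgroup.map_top_of_surjective _ (FiniteField.unitsMap_norm_surjective F E)

/-- For `x = ω ^ j` and `y = α ^ s`, the ratio `N y / x = ω ^ (s - j)` is in the prime field iff `N
∣ s - j`, that is, iff `x` and `y` share an index `i` modulo `N`. The adjoined `0` is the case `c =
0`. -/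
theorem dennistonSet_map_norm_eq_normLineSet [CharP F p] (hm : 0 < m)
    (hF : Nat.card F = p ^ m) {α : Eˣ} (hα : Subgroup.zpowers α = ⊤) :
    dennistonSet p m (Units.map (Algebra.norm F) α) α = normLineSet (ZMod p) F E := by
  have hp := (Fact.out : p.Prime)
  have hω := zpowers_map_norm_eq_top (F := F) hα
  set ω : Fˣ := Units.map (Algebra.norm F) α with hωα
  have hmem := mem_zpowers_pow_iff_exists_algebraMap hF hω
  have hNdvd : (p ^ m - 1) / (p - 1) ∣ p ^ m - 1 :=
    Nat.div_dvd_of_dvd (Nat.sub_one_dvd_pow_sub_one p m)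
  have hNω : (p ^ m - 1) / (p - 1) ∣ orderOf ω := by
    rwa [orderOf_of_zpowers_eq_top hω, hF]
  have hNpos : 0 < (p ^ m - 1) / (p - 1) :=
    Nat.pos_of_dvd_of_pos hNdvd (Nat.sub_pos_of_lt (Nat.one_lt_pow hm.ne' hp.one_lt))
  set N := (p ^ m - 1) / (p - 1) with hN
  ext ⟨x, y⟩
  simp only [dennistonSet, ← hN, Set.mem_iUnion, Finset.mem_range, Set.mem_prod, Set.mem_union,
    Set.mem_ofPred_eq, Set.mem_singleton_iff, exists_prop, mem_normLineSet]
  constructor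
  · rintro ⟨i, -, ⟨h, hh, rfl⟩, hy⟩
    refine ⟨Units.ne_zero _, ?_⟩
    rcases hy with ⟨h', ⟨k, rfl⟩, rfl⟩ | rfl
    · have h1 : Algebra.norm F (((α ^ i * (α ^ N) ^ k : Eˣ)) : E) =
          ((ω ^ i * (ω ^ N) ^ k : Fˣ) : F) := by
        rw [← Units.coe_map, map_mul, map_zpow, map_pow, map_pow]
      obtain ⟨c, hc⟩ := (hmem ((ω ^ N) ^ k * h⁻¹)).1
        (mul_mem (zpow_mem (Subgroup.mem_zpowers _) k) (inv_mem hh))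
      refine ⟨c, ?_⟩
      simp only
      rw [h1, Algebra.smul_def, ← hc, ← Units.val_mul]
      congr 1
      rw [mul_left_comm, inv_mul_cancel_right]
    · exact ⟨0, by rw [Algebra.norm_zero, zero_smul]⟩
  · rintro ⟨hx, c, hc⟩
    obtain ⟨j, hj⟩ : Units.mk0 x hx ∈ Subgroup.zpowers ω := hω ▸ Subgroup.mem_top _
    simp only at hj
    have hjx : x = ((ω ^ j : Fˣ) : F) := by rw [hj, Units.val_mk0]
    have hN0 : (N : ℤ) ≠ 0 := by exact_mod_cast hNpos.ne'
    have hi : (((j % N).toNat : ℕ) : ℤ) = j % N := Int.toNat_of_nonneg (Int.emod_nonneg _ hN0)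
    have hsub : ∀ s : ℤ, (N : ℤ) ∣ s - j → (N : ℤ) ∣ s - (j % N).toNat := fun s hs => by
      rw [hi, Int.emod_def, ← sub_add]
      exact dvd_add hs (dvd_mul_right _ _)
    refine ⟨(j % N).toNat, ?_, ⟨ω ^ (j - (j % N).toNat), ?_, ?_⟩, ?_⟩
    · have := Int.emod_lt_of_pos j (by exact_mod_cast hNpos : (0 : ℤ) < N)
      omega
    · exact (zpow_mem_zpowers_pow_iff hNω _).2 (hsub j (by simp))
    · rw [hjx, ← zpow_natCast, ← zpow_add, add_sub_cancel]
    · rcases eq_or_ne y 0 with rfl | hy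
      · exact Or.inr rfl
      · left
        obtain ⟨s, hs⟩ : Units.mk0 y hy ∈ Subgroup.zpowers α := hα ▸ Subgroup.mem_top _
        simp only at hs
        have hsy : y = ((α ^ s : Eˣ) : E) := by rw [hs, Units.val_mk0]
        have hsN : ω ^ (s - j) ∈ Subgroup.zpowers (ω ^ N) := by
          refine (hmem _).2 ⟨c, ?_⟩
          have h1 : Algebra.norm F y = ((ω ^ s : Fˣ) : F) := by
            rw [hsy, ← Units.coe_map, map_zpow]
          rw [zpow_sub, Units.val_mul, ← h1, hc, hjx, Algebra.smul_def, Units.mul_inv_cancel_right]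
        refine ⟨α ^ (s - (j % N).toNat), ?_, ?_⟩
        · obtain ⟨k, hk⟩ := hsub s ((zpow_mem_zpowers_pow_iff hNω _).1 hsN)
          exact ⟨k, by simp only [hk, zpow_mul, zpow_natCast]⟩
        · rw [hsy, ← zpow_natCast, ← zpow_add, add_sub_cancel]

end DennistonSet

/-- Otherwise the exponent `p ^ k - 1` of the cyclic group of units would divide the smaller number
`p ^ n - 1`. -/
theorem exists_pow_prime_pow_ne {p : ℕ} [Fact p.Prime] {E : Type*} [Field E] [Finite E] {k n : ℕ} (hE : Nat.card E = p ^ k) (hn : 0 < n) (hnk : n < k) :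
    ∃ y : E, y ^ p ^ n ≠ y := by
  have hp := (Fact.out : p.Prime)
  by_contra! h
  have := Fintype.ofFinite E
  have hdvd := (FiniteField.forall_pow_eq_one_iff E (p ^ n - 1)).1 fun y => by
    apply mul_right_cancel (b := y)
    rw [← pow_succ, Nat.sub_add_cancel (Nat.one_le_pow _ _ hp.pos), one_mul]
    ext
    rw [Units.val_pow_eq_pow_val, h]
  rw [← Nat.card_eq_fintype_card, hE] at hdvd
  have h1 := Nat.le_of_dvd (Nat.sub_pos_of_lt (Nat.one_lt_pow hn.ne' hp.one_lt)) hdvd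
  have h2 := Nat.pow_lt_pow_right hp.one_lt hnk
  have h3 := Nat.one_lt_pow hn.ne' hp.one_lt
  omega

/-! ### The Frobenius automorphism and its trace-twisted action -/

section Frobenius

variable {p : ℕ} [Fact p.Prime] {F E : Type*} [Field F] [Field E]

/-- The homomorphism `(x, y) ↦ φ ^ Tr x` for an automorphism `φ` of order `p`. -/
noncomputable def powTraceHom [Algebra (ZMod p) F] (φ : MulAut (Multiplicative (F × E)))
    (hφ : orderOf φ = p) : Multiplicative (F × E) →* MulAut (Multiplicative (F × E)) where
  toFun g := φ ^ (Algebra.trace (ZMod p) F g.toAdd.1).val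
  map_one' := by simp
  map_mul' g h := by
    rw [← pow_add, toAdd_mul, Prod.fst_add, map_add, ZMod.val_add, pow_eq_pow_iff_modEq, hφ]
    exact Nat.mod_modEq _ _

theorem powTraceHom_apply [Algebra (ZMod p) F] {φ : MulAut (Multiplicative (F × E))}
    (hφ : orderOf φ = p) (g : Multiplicative (F × E)) :
    powTraceHom φ hφ g = φ ^ (Algebra.trace (ZMod p) F g.toAdd.1).val := rfl

variable [Finite F] [Finite E] [CharP F p] [CharP E p]

theorem frobeniusPowerAut_apply (n : ℕ) (g : Multiplicative (F × E)) :
    frobeniusPowerAut F E p n g =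
      Multiplicative.ofAdd (g.toAdd.1 ^ p ^ n, g.toAdd.2 ^ p ^ n) := rfl

theorem frobeniusPowerAut_pow (n k : ℕ) :
    frobeniusPowerAut F E p n ^ k = frobeniusPowerAut F E p (n * k) := by
  induction k with
  | zero =>
    refine MulEquiv.ext fun g => ?_
    simp [frobeniusPowerAut_apply]
  | succ k ih =>
    refine MulEquiv.ext fun g => ?_
    rw [pow_succ, ih, MulAut.mul_apply]
    simp only [frobeniusPowerAut_apply, toAdd_ofAdd, ← pow_mul, ← pow_add]
    rw [mul_add_one, add_comm n]

theorem orderOf_frobeniusPowerAut {n : ℕ} (hF : ∀ x : F, x ^ p ^ (n * p) = x)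
    (hE : ∀ y : E, y ^ p ^ (n * p) = y) (hne : ∃ y : E, y ^ p ^ n ≠ y) :
    orderOf (frobeniusPowerAut F E p n) = p := by
  refine orderOf_eq_prime ?_ fun h => ?_
  · refine MulEquiv.ext fun g => ?_
    rw [frobeniusPowerAut_pow, frobeniusPowerAut_apply, hF, hE]
    rfl
  · obtain ⟨y, hy⟩ := hne
    exact hy (congrArg (fun g => g.toAdd.2)
      (DFunLike.congr_fun h (Multiplicative.ofAdd ((0 : F), y))))

/-- Frobenius powers commute with the norm and fix the prime-field scalar `c`, so the same `c`
works. -/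
theorem frobeniusPowerAut_mem_normLineSet_iff [Algebra (ZMod p) F] [Algebra F E] (n : ℕ)
    (g : Multiplicative (F × E)) :
    frobeniusPowerAut F E p n g ∈ Multiplicative.toAdd ⁻¹' normLineSet (ZMod p) F E ↔
      g ∈ Multiplicative.toAdd ⁻¹' normLineSet (ZMod p) F E := by
  simp only [Set.mem_preimage, mem_normLineSet, frobeniusPowerAut_apply, toAdd_ofAdd, map_pow]
  refine and_congr (pow_ne_zero_iff (pow_ne_zero _ (Fact.out : p.Prime).ne_zero))
    (exists_congr fun c => ?_)
  have h := (iterateFrobeniusEquiv F p n).injective.eq_iff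
    (a := Algebra.norm F g.toAdd.2) (b := c • g.toAdd.1)
  rwa [iterateFrobeniusEquiv_def, iterateFrobeniusEquiv_def, smul_pow, ZMod.pow_card_pow] at h

theorem trace_pow_prime_pow [Algebra (ZMod p) F] (n : ℕ) (x : F) :
    Algebra.trace (ZMod p) F (x ^ p ^ n) = Algebra.trace (ZMod p) F x :=
  Algebra.trace_eq_of_algEquiv
    (AlgEquiv.ofRingEquiv (f := iterateFrobeniusEquiv F p n) fun c => by
      rw [iterateFrobeniusEquiv_def, ← map_pow, ZMod.pow_card_pow]) x

theorem powTraceHom_frobeniusPowerAut [Algebra (ZMod p) F] {n : ℕ}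
    (hφ : orderOf (frobeniusPowerAut F E p n) = p) (a b : Multiplicative (F × E)) :
    powTraceHom _ hφ (powTraceHom _ hφ a b) = powTraceHom _ hφ b := by
  have h : (powTraceHom _ hφ a b).toAdd.1 =
      b.toAdd.1 ^ p ^ (n * (Algebra.trace (ZMod p) F a.toAdd.1).val) := by
    rw [powTraceHom_apply, frobeniusPowerAut_pow, frobeniusPowerAut_apply, toAdd_ofAdd]
  rw [powTraceHom_apply, h, trace_pow_prime_pow, powTraceHom_apply]

end Frobenius

/-! ### The abelian and nonabelian partial difference sets -/

section FieldTower

variable {p m : ℕ} [Fact p.Prime] {F E : Type*} [Field F] [Field E] [Finite F] [Finite E]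
  [Algebra (ZMod p) F] [Algebra F E]

theorem isOddDennistonPDS_normLineSet (hF : Nat.card F = p ^ m)
    (h2 : Module.finrank F E = 2) :
    IsOddDennistonPDS (Multiplicative.toAdd ⁻¹' normLineSet (ZMod p) F E) p m := by
  have := Fintype.ofFinite F
  have := Fintype.ofFinite E
  have h := isPartialDifferenceSet_normLineSet (K := ZMod p) h2
  rw [ZMod.card, ← Nat.card_eq_fintype_card (α := F), hF] at h
  rw [IsOddDennistonPDS, mul_comm 3 m, pow_mul, pow_succ' p m]
  exact h

/-- The semidirect product of `F × E` and `⟨φ⟩` contains a nonabelian group that acts regularly on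
`F × E` and to which the partial difference set lifts. -/
theorem exists_nonabelian_subgroup_isOddDennistonPDS [CharP F p] [CharP E p] {n : ℕ}
    (hF : Nat.card F = p ^ m) (h2 : Module.finrank F E = 2) (hφ : orderOf (frobeniusPowerAut F E p n) = p)
    (hne : ∃ y : E, y ^ p ^ n ≠ y) :
    ∃ 𝒢 : Subgroup (Holomorph (Multiplicative (F × E))),
      (∀ g ∈ 𝒢, g.right ∈ Subgroup.zpowers (frobeniusPowerAut F E p n)) ∧
      (∃ a ∈ 𝒢, ∃ b ∈ 𝒢, a * b ≠ b * a) ∧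
      Nat.card 𝒢 = p ^ (3 * m) ∧
      IsOddDennistonPDS {g : 𝒢 | (g : Holomorph (Multiplicative (F × E))).left ∈
        Multiplicative.toAdd ⁻¹' normLineSet (ZMod p) F E} p m := by
  have hpds := (isOddDennistonPDS_normLineSet hF h2).holomorphGraph
    (hρ := powTraceHom_frobeniusPowerAut hφ) fun a b => by
      rw [powTraceHom_apply, frobeniusPowerAut_pow, frobeniusPowerAut_mem_normLineSet_iff]
  refine ⟨holomorphGraph (powTraceHom _ hφ) (powTraceHom_frobeniusPowerAut hφ), fun g hg => ?_,
    ?_, hpds.2.1, hpds⟩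
  · rw [mem_holomorphGraph.1 hg, powTraceHom_apply]
    exact Subgroup.npow_mem_zpowers _ _
  · obtain ⟨y, hy⟩ := hne
    -- With `Tr x = 1`, `(x, 0)` acts as `φ` while `(0, y)` acts trivially; the two products are
    -- `(x, φ y)` and `(x, y)`.
    obtain ⟨x, hx⟩ := Algebra.trace_surjective (ZMod p) F 1
    have := (Fact.out : p.Prime).one_lt
    let ε := holomorphGraphEquiv (powTraceHom _ hφ) (powTraceHom_frobeniusPowerAut hφ)
    let a := ε.symm (Multiplicative.ofAdd (x, 0))
    let b := ε.symm (Multiplicative.ofAdd (0, y))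
    have hb : powTraceHom _ hφ (Multiplicative.ofAdd ((0 : F), y)) = 1 := by
      rw [powTraceHom_apply, toAdd_ofAdd, map_zero, ZMod.val_zero, pow_zero]
    have ha : powTraceHom _ hφ (Multiplicative.ofAdd (x, (0 : E))) =
        frobeniusPowerAut F E p n := by
      have : Fact (1 < p) := ⟨this⟩
      rw [powTraceHom_apply, toAdd_ofAdd, hx, ZMod.val_one, pow_one]
    refine ⟨a, a.2, b, b.2, fun h => hy ?_⟩
    have h' : ε (a * b) = ε (b * a) := congrArg ε (Subtype.ext h)
    rw [holomorphGraphEquiv_mul, holomorphGraphEquiv_mul, Equiv.apply_symm_apply,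
      Equiv.apply_symm_apply, ha, hb] at h'
    have h2 := congrArg (fun g => g.toAdd.2) h'
    simpa [frobeniusPowerAut_apply] using h2

end FieldTower

/-! ### Galois fields and the main theorem -/

theorem GaloisField.pow_pow_eq_self (p : ℕ) [Fact p.Prime] {k n : ℕ} (hk : k ≠ 0) (h : k ∣ n)
    (x : GaloisField p k) : x ^ p ^ n = x := by
  have := Fintype.ofFinite (GaloisField p k)
  obtain ⟨d, rfl⟩ := h
  rw [pow_mul, ← GaloisField.card p k hk, Nat.card_eq_fintype_card, FiniteField.pow_card_pow]

theorem GaloisField.exists_algebra_finrank_two (p : ℕ) [Fact p.Prime] {m : ℕ} (hm : m ≠ 0) :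
    ∃ _ : Algebra (GaloisField p m) (GaloisField p (2 * m)),
      Module.finrank (GaloisField p m) (GaloisField p (2 * m)) = 2 := by
  have h2m : 2 * m ≠ 0 := mul_ne_zero two_ne_zero hm
  obtain ⟨f⟩ := FiniteField.nonempty_algHom_of_finrank_dvd (F := ZMod p) (K := GaloisField p m)
    (L := GaloisField p (2 * m)) (by
      rw [GaloisField.finrank p hm, GaloisField.finrank p h2m]
      exact dvd_mul_left _ _)
  let := f.toRingHom.toAlgebra
  refine ⟨inferInstance, ?_⟩
  have h := Module.natCard_eq_pow_finrank (K := GaloisField p m) (V := GaloisField p (2 * m))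
  rw [GaloisField.card p m hm, GaloisField.card p _ h2m, ← pow_mul] at h
  exact (Nat.eq_of_mul_eq_mul_left (Nat.pos_of_ne_zero hm)
    ((mul_comm m 2).trans (Nat.pow_right_injective (Fact.out : p.Prime).two_le h))).symm

theorem theorem6p7 (p t m : ℕ) [Fact p.Prime] (hp : Odd p) (ht : 0 < t) (hm : m = p * t) :
    ∃ (ω : (GaloisField p m)ˣ) (α : (GaloisField p (2 * m))ˣ)
      (φ : MulAut (Multiplicative (GaloisField p m × GaloisField p (2 * m))))
      (D : Set (Multiplicative (GaloisField p m × GaloisField p (2 * m)))),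
      -- `ω` and `α` are primitive elements
      Subgroup.zpowers ω = ⊤ ∧ Subgroup.zpowers α = ⊤ ∧
      -- the partial difference set in the elementary abelian group
      D = Multiplicative.toAdd ⁻¹' dennistonSet p m ω α ∧
      IsOddDennistonPDS D p m ∧
      -- the automorphism of order `p` preserving it
      φ = frobeniusPowerAut (GaloisField p m) (GaloisField p (2 * m)) p (2 * t) ∧
      orderOf φ = p ∧ φ '' D = D ∧
      -- the nonabelian group, inside the semidirect product with `⟨φ⟩`
      ∃ 𝒢 : Subgroup (Holomorph (Multiplicative (GaloisField p m × GaloisField p (2 * m)))),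
        (∀ g ∈ 𝒢, g.right ∈ Subgroup.zpowers φ) ∧
        (∃ a ∈ 𝒢, ∃ b ∈ 𝒢, a * b ≠ b * a) ∧
        Nat.card 𝒢 = p ^ (3 * m) ∧
        IsOddDennistonPDS
          {g : 𝒢 | (g : Holomorph (Multiplicative
            (GaloisField p m × GaloisField p (2 * m)))).left ∈ D} p m := by
  have hp2 : 1 < p := (Fact.out : p.Prime).one_lt
  have hm0 : 0 < m := hm ▸ Nat.mul_pos (Nat.zero_lt_of_lt hp2) ht
  have h2m0 : 2 * m ≠ 0 := (Nat.mul_pos two_pos hm0).ne'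
  have hF := GaloisField.card p m hm0.ne'
  obtain ⟨_, h2⟩ := GaloisField.exists_algebra_finrank_two p hm0.ne'
  obtain ⟨α, hα⟩ := IsCyclic.exists_generator (α := (GaloisField p (2 * m))ˣ)
  have hα' : Subgroup.zpowers α = ⊤ := (Subgroup.eq_top_iff' _).2 hα
  have hD := dennistonSet_map_norm_eq_normLineSet hm0 hF hα'
  have hne : ∃ y : GaloisField p (2 * m), y ^ p ^ (2 * t) ≠ y :=
    exists_pow_prime_pow_ne (GaloisField.card p _ h2m0) (Nat.mul_pos two_pos ht) (by nlinarith)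
  -- `φ ^ p` is the `p ^ (2m)`-power map, trivial on both fields.
  have hexp : 2 * t * p = 2 * m := by rw [hm, mul_assoc, mul_comm t]
  have hφ : orderOf (frobeniusPowerAut (GaloisField p m) (GaloisField p (2 * m)) p (2 * t)) = p :=
    orderOf_frobeniusPowerAut
      (GaloisField.pow_pow_eq_self p hm0.ne' (hexp ▸ dvd_mul_left _ _))
      (GaloisField.pow_pow_eq_self p h2m0 (hexp ▸ dvd_rfl)) hne
  -- `α` is any generator, but `ω` is tied to it as its norm.
  refine ⟨Units.map (Algebra.norm (GaloisField p m)) α, α, _, _, zpowers_map_norm_eq_top hα', hα',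
    rfl, ?_, rfl, hφ, ?_, ?_⟩
  · rw [hD]
    exact isOddDennistonPDS_normLineSet hF h2
  · rw [hD]
    ext g
    obtain ⟨g, rfl⟩ := (frobeniusPowerAut (GaloisField p m) (GaloisField p (2 * m)) p
      (2 * t)).surjective g
    rw [(MulEquiv.injective _).mem_set_image, frobeniusPowerAut_mem_normLineSet_iff]
  · rw [hD]
    exact exists_nonabelian_subgroup_isOddDennistonPDS hF h2 hφ hne
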